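/- Let $k$ be an algebraically closed field. A variety over $k$ is an integral separated scheme of finite type over $k$. Let $f\colon X\to Y$ be a dominant morphism of varieties over $k$. Then $\dim X$ and $\dim Y$ are finite and $r:=\dim X-\dim Y\ge 0$. Moreover, there is a nonempty open subset $U\subseteq Y$ such that: 1. $U\subseteq f(X)$; 2. for every irreducible closed subset $W\subseteq Y$ with $W\cap U\neq\emptyset$ and every irreducible component $Z$ of $f^{-1}(W)$ with $Z\cap f^{-1}(U)\neq\emptyset$, $$\dim Z=\dim W+r\quad\text{and}\quad \operatorname{codim}(Z,X)=\operatorname{codim}(W,Y).$$ Here $\dim$ is the Krull dimension of the underlying topological space, and $\operatorname{codim}(Z,X)$ is the supremum of the integers $n$ for which there is a chain $Z=Z_0\subsetneq Z_1\subsetneq\dots\subsetneq Z_n$ of irreducible closed subsets of $X$ (likewise for $W$ in $Y$). -/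

import Mathlib

open AlgebraicGeometry CategoryTheory TopologicalSpace

universe u

/-- A variety over a field `k` (in the theorem `k` is algebraically closed): an integral scheme
which is separated and of finite type over `k`. -/
class IsVariety {k : Type u} [Field k] (X : Over (Spec (CommRingCat.of k))) : Prop where
  isIntegral : IsIntegral X.left
  isSeparated : IsSeparated X.hom
  locallyOfFiniteType : LocallyOfFiniteType X.hom
  quasiCompact : QuasiCompact X.hom

/-- The irreducible components of a subset `S` of a topological space `T`, that is, of `S` with its
subspace topology, regarded as subsets of `T`. -/
def irreducibleComponentsOf {T : Type*} [TopologicalSpace T] (S : Set T) : Set (Set T) :=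
  (fun C : Set S => Subtype.val '' C) '' irreducibleComponents S

/-- The irreducible components of a closed subset are irreducible closed subsets of the ambient
space. Hence nothing is lost by quantifying over those components which are given as elements
of `IrreducibleCloseds T`. -/
theorem exists_irreducibleCloseds_of_mem_irreducibleComponentsOf {T : Type*} [TopologicalSpace T]
    {S : Set T} (hS : IsClosed S) {Z : Set T} (hZ : Z ∈ irreducibleComponentsOf S) :
    ∃ Z' : IrreducibleCloseds T, (Z' : Set T) = Z := by
  obtain ⟨C, hC, rfl⟩ := hZ
  exact ⟨⟨Subtype.val '' C, hC.1.image _ continuous_subtype_val.continuousOn,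
    hS.isClosedEmbedding_subtypeVal.isClosedMap _
      (isClosed_of_mem_irreducibleComponents C hC)⟩, rfl⟩

/-- The codimension of an irreducible closed subset `Z` of a topological space: the supremum of the
lengths of chains `Z = Z₀ ⊊ Z₁ ⊊ ⋯ ⊊ Zₙ` of irreducible closed subsets. -/
noncomputable def codimension {T : Type*} [TopologicalSpace T] (Z : IrreducibleCloseds T) : ℕ∞ :=
  Order.coheight Z

theorem MvPolynomial.height_eq_of_isMaximal (k : Type*) [Field k] (n : ℕ)
    (m : Ideal (MvPolynomial (Fin n) k)) [hm : m.IsMaximal] : m.height = n := by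
  induction n with
  | zero =>
    have hf : IsField (MvPolynomial (Fin 0) k) :=
      (MvPolynomial.isEmptyAlgEquiv k (Fin 0)).toMulEquiv.isField (Field.toIsField k)
    let := hf.toField
    have : m = ⊥ := (Ideal.eq_bot_or_top m).resolve_right hm.ne_top
    subst this
    simp
  | succ n ih =>
    let e := (MvPolynomial.finSuccEquiv k n).toRingEquiv
    let M := m.map e
    have hM : M.IsMaximal := Ideal.map_isMaximal_of_equiv e
    let M' : Ideal (MvPolynomial (Fin n) k) := M.comap Polynomial.C
    have h1 : M'.IsMaximal := Polynomial.isMaximal_comap_C_of_isJacobsonRing M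
    have h0 : M.LiesOver M' := ⟨rfl⟩
    have h2 := Polynomial.height_eq_height_add_one M' M
    rw [ih] at h2
    have h3 : M.height = m.height := RingEquiv.height_map e m
    rw [← h3, h2]; simp

/-- Under going down, a prime which is minimal in its fibre has the height of the prime below. -/
theorem Ideal.height_eq_of_mem_minimalPrimes_map {R S : Type*} [CommRing R] [CommRing S]
    [Algebra R S] [IsNoetherianRing R] [IsNoetherianRing S] [Algebra.HasGoingDown R S]
    (p : Ideal R) [p.IsPrime] (P : Ideal S) [P.IsPrime] [P.LiesOver p]
    (hP : P ∈ (p.map (algebraMap R S)).minimalPrimes) : P.height = p.height := by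
  have h := Ideal.height_eq_height_add_of_liesOver_of_hasGoingDown p P
  have hle : p.map (algebraMap R S) ≤ P := hP.1.2
  have hpr : (P.map (Ideal.Quotient.mk (p.map (algebraMap R S)))).IsPrime :=
    Ideal.map_isPrime_of_surjective Ideal.Quotient.mk_surjective (by simpa using hle)
  have h0 : (P.map (Ideal.Quotient.mk (p.map (algebraMap R S)))).height = 0 := by
    rw [Ideal.height_eq_zero_iff]
    refine ⟨⟨hpr, bot_le⟩, fun Q hQ hQP ↦ ?_⟩
    have hQ1 := hQ.1
    have := hP.2 (y := Q.comap (Ideal.Quotient.mk _)) ⟨inferInstance, fun x hx ↦ by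
      rw [Ideal.mem_comap, Ideal.Quotient.eq_zero_iff_mem.mpr hx]; exact Q.zero_mem⟩ (by
        refine (Ideal.comap_mono hQP).trans ?_
        rw [Ideal.comap_map_of_surjective' _ Ideal.Quotient.mk_surjective]
        simpa using hle)
    exact Ideal.map_le_iff_le_comap.mpr this
  rw [h, h0, add_zero]

theorem Ideal.height_under_of_isIntegral {R S : Type*} [CommRing R] [CommRing S]
    [Algebra R S] [IsNoetherianRing R] [IsNoetherianRing S] [Algebra.HasGoingDown R S]
    [Algebra.IsIntegral R S] (P : Ideal S) [P.IsPrime] : (P.under R).height = P.height :=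
  (Ideal.height_eq_of_mem_minimalPrimes_map (P.under R) P
    (Ideal.IsIntegral.mem_minimalPrimes_map_under P)).symm

/-- The dimension of a finitely generated domain over a field is its transcendence degree, and
it is the height of every maximal ideal. -/
theorem exists_ringKrullDim_eq_trdeg (k : Type*) [Field k] (B : Type*) [CommRing B] [IsDomain B]
    [Algebra k B] [Algebra.FiniteType k B] :
    ∃ n : ℕ, Algebra.trdeg k B = n ∧ ringKrullDim B = n ∧
      ∀ m : Ideal B, m.IsMaximal → m.height = n := by
  obtain ⟨n, g, hg, hfin⟩ := exists_finite_inj_algHom_of_fg k B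
  let := g.toRingHom.toAlgebra
  have : Module.Finite (MvPolynomial (Fin n) k) B := hfin
  have : FaithfulSMul (MvPolynomial (Fin n) k) B :=
    (faithfulSMul_iff_algebraMap_injective _ _).mpr hg
  have : IsScalarTower k (MvPolynomial (Fin n) k) B := .of_algebraMap_eq fun x ↦ (g.commutes x).symm
  have : IsNoetherianRing B := Algebra.FiniteType.isNoetherianRing k B
  have : Algebra.IsIntegral (MvPolynomial (Fin n) k) B := inferInstance
  have hmax : ∀ m : Ideal B, m.IsMaximal → m.height = n := fun m hm ↦ by
    have := Ideal.isMaximal_comap_of_isIntegral_of_isMaximal (R := MvPolynomial (Fin n) k) m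
    rw [← Ideal.height_under_of_isIntegral (R := MvPolynomial (Fin n) k) m]
    exact MvPolynomial.height_eq_of_isMaximal k n _
  refine ⟨n, ?_, ?_, hmax⟩
  · have h := lift_trdeg_add_eq k (MvPolynomial (Fin n) k) B
    rw [trdeg_eq_zero (R := MvPolynomial (Fin n) k) (A := B), MvPolynomial.trdeg_of_isDomain] at h
    simpa using h.symm
  · refine le_antisymm ((ringKrullDim_le_iff_isMaximal_height_le _).mpr fun m hm ↦ ?_) ?_
    · rw [hmax m hm]; rfl
    · obtain ⟨m, hm⟩ := Ideal.exists_maximal B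
      have := Ideal.height_le_ringKrullDim_of_ne_top hm.ne_top
      rwa [hmax m hm] at this

theorem Ideal.height_add_ringKrullDim_quotient (k : Type u) [Field k] (B : Type u) [CommRing B]
    [IsDomain B] [Algebra k B] [Algebra.FiniteType k B] (P : Ideal B) [hP : P.IsPrime] :
    (P.height : WithBot ℕ∞) + ringKrullDim (B ⧸ P) = ringKrullDim B := by
  obtain ⟨n, hn, hdn, -⟩ := exists_ringKrullDim_eq_trdeg k B
  obtain ⟨t, ht, hdt, -⟩ := exists_ringKrullDim_eq_trdeg k (B ⧸ P)
  have : FaithfulSMul k (B ⧸ P) :=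
    (faithfulSMul_iff_algebraMap_injective _ _).mpr (algebraMap k (B ⧸ P)).injective
  obtain ⟨s, hs⟩ := exists_isTranscendenceBasis k (B ⧸ P)
  have hst : Cardinal.mk s = t := hs.cardinalMk_eq_trdeg.trans ht
  obtain ⟨e⟩ := Cardinal.eq.mp (show Cardinal.mk s = Cardinal.mk (ULift.{u} (Fin t)) by simp [hst])
  let x : Fin t → B ⧸ P := fun i ↦ (e.symm ⟨i⟩ : B ⧸ P)
  have hx : AlgebraicIndependent k x :=
    hs.1.comp (fun i : Fin t ↦ e.symm ⟨i⟩) (fun i j h ↦ by simpa using h)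
  choose b hb using fun i ↦ Ideal.Quotient.mk_surjective (x i)
  have hb' : AlgebraicIndependent k b := by
    refine .of_comp (IsScalarTower.toAlgHom k B (B ⧸ P)) ?_
    convert hx using 1
    exact funext hb
  let R := MvPolynomial (Fin t) k
  let : Algebra R B := (MvPolynomial.aeval b).toAlgebra
  have hRB : Function.Injective (algebraMap R B) := hb'
  have : FaithfulSMul R B := (faithfulSMul_iff_algebraMap_injective _ _).mpr hRB
  have : IsScalarTower k R B := .of_algebraMap_eq fun c ↦ (MvPolynomial.aeval_C b c).symm
  have hRQ : Function.Injective (algebraMap R (B ⧸ P)) := by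
    have : (algebraMap R (B ⧸ P)) = (MvPolynomial.aeval x : R →ₐ[k] B ⧸ P).toRingHom := by
      have : (MvPolynomial.aeval x : R →ₐ[k] B ⧸ P) =
          (IsScalarTower.toAlgHom k B (B ⧸ P)).comp (MvPolynomial.aeval b) := by
        ext i; simp [← hb]
      rw [this]; rfl
    rw [this]; exact hx
  have : FaithfulSMul R (B ⧸ P) := (faithfulSMul_iff_algebraMap_injective _ _).mpr hRQ
  have : IsScalarTower k R (B ⧸ P) := .of_algebraMap_eq fun c ↦ by
    rw [IsScalarTower.algebraMap_apply k B (B ⧸ P), IsScalarTower.algebraMap_apply k R B]; rfl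
  have hkR : Algebra.trdeg k R = t := by
    rw [MvPolynomial.trdeg_of_isDomain]; simp
  have halg : Algebra.IsAlgebraic R (B ⧸ P) := by
    have h := trdeg_add_eq k R (A := B ⧸ P)
    rw [hkR, ht] at h
    rw [← trdeg_eq_zero_iff]
    exact Cardinal.eq_of_add_eq_add_left (by simpa using h) (Cardinal.natCast_lt_aleph0)
  let K := FractionRing R
  let S := Algebra.algebraMapSubmonoid B (nonZeroDivisors R)
  have hS : S ≤ nonZeroDivisors B :=
    map_le_nonZeroDivisors_of_injective _ hRB le_rfl
  let B' := Localization S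
  have : IsDomain B' := IsLocalization.isDomain_localization hS
  let : Algebra K B' := localizationAlgebra (nonZeroDivisors R) B
  have : IsScalarTower R K B' := isScalarTower_localizationAlgebra (nonZeroDivisors R) B
  have hBB' : Function.Injective (algebraMap B B') := IsLocalization.injective B' hS
  have : FaithfulSMul B B' := (faithfulSMul_iff_algebraMap_injective _ _).mpr hBB'
  have : FaithfulSMul R B' := by
    rw [faithfulSMul_iff_algebraMap_injective, IsScalarTower.algebraMap_eq R B B']
    exact hBB'.comp hRB
  have : Algebra.FiniteType K B' := by
    have h : (algebraMap R B).FiniteType := RingHom.finiteType_algebraMap.mpr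
      (.of_restrictScalars_finiteType k R B)
    have : IsLocalization ((nonZeroDivisors R).map (algebraMap R B)) B' :=
      inferInstanceAs (IsLocalization S B')
    exact RingHom.finiteType_localizationPreserves (algebraMap R B) (nonZeroDivisors R) K B' h
  obtain ⟨m, hm, -, hmax⟩ := exists_ringKrullDim_eq_trdeg K B'
  have hntm : n = t + m := by
    have : FaithfulSMul K B' :=
      (faithfulSMul_iff_algebraMap_injective _ _).mpr (algebraMap K B').injective
    have h1 := trdeg_add_eq R K (A := B')
    have h2 := trdeg_add_eq R B (A := B')
    have h3 := trdeg_add_eq k R (A := B)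
    have : Algebra.IsAlgebraic R K := IsLocalization.isAlgebraic K (nonZeroDivisors R)
    have : Algebra.IsAlgebraic B B' := IsLocalization.isAlgebraic B' S
    rw [trdeg_eq_zero (R := R) (A := K), hm, zero_add] at h1
    rw [trdeg_eq_zero (R := B) (A := B'), add_zero, ← h1] at h2
    rw [h2, hkR, hn] at h3
    exact_mod_cast h3.symm
  have hdisj : Disjoint (S : Set B) P := by
    rw [Set.disjoint_left]
    rintro _ ⟨r, hr, rfl⟩ hrP
    have : algebraMap R (B ⧸ P) r = 0 := Ideal.Quotient.eq_zero_iff_mem.mpr hrP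
    exact nonZeroDivisors.ne_zero hr (hRQ (by rw [this, map_zero]))
  have hmaxP : (P.map (algebraMap B B')).IsMaximal := by
    have hPp := IsLocalization.isPrime_of_isPrime_disjoint S B' P hP hdisj
    obtain ⟨Q, hQ, hPQ⟩ := Ideal.exists_le_maximal _ hPp.ne_top
    suffices Q.comap (algebraMap B B') ≤ P by
      have : Q ≤ P.map (algebraMap B B') := by
        rw [← IsLocalization.map_under S B' Q]
        exact Ideal.map_mono this
      rwa [le_antisymm hPQ this]
    intro y hy
    by_contra hyP
    have hPQ' : P ≤ Q.comap (algebraMap B B') := Ideal.map_le_iff_le_comap.mp hPQ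
    have hne : Ideal.Quotient.mk P y ≠ 0 := fun h ↦ hyP (Ideal.Quotient.eq_zero_iff_mem.mp h)
    have := Ideal.comap_ne_bot_of_algebraic_mem (R := R) hne
      (Ideal.mem_map_of_mem (Ideal.Quotient.mk P) hy) (halg.isAlgebraic _)
    obtain ⟨r, hr, hr0⟩ := Submodule.exists_mem_ne_zero_of_ne_bot this
    have hrQ : algebraMap R B r ∈ Q.comap (algebraMap B B') := by
      have : Ideal.Quotient.mk P (algebraMap R B r) ∈
        (Q.comap (algebraMap B B')).map (Ideal.Quotient.mk P) := hr
      rwa [Ideal.mem_quotient_iff_mem hPQ'] at this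
    exact hQ.ne_top (Ideal.eq_top_of_isUnit_mem _ hrQ
      (IsLocalization.map_units B' (⟨_, r, mem_nonZeroDivisors_of_ne_zero hr0, rfl⟩ : S)))
  have hh := hmax _ hmaxP
  rw [IsLocalization.height_map_of_disjoint S P hdisj] at hh
  rw [hh, hdt, hdn, hntm, add_comm]
  norm_cast

open TensorProduct in
/-- An étale domain over a normal domain is normal. -/
theorem IsIntegrallyClosed.of_etale (R S : Type*) [CommRing R] [CommRing S] [IsDomain R] [IsDomain S]
    [Algebra R S] [IsIntegrallyClosed R] [Algebra.Etale R S] : IsIntegrallyClosed S := by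
  let K := FractionRing R
  have hflat : Module.Flat R S := inferInstance
  have hRS : Function.Injective (algebraMap R S) := FaithfulSMul.algebraMap_injective R S
  have hM : Algebra.algebraMapSubmonoid S (nonZeroDivisors R) ≤ nonZeroDivisors S :=
    map_le_nonZeroDivisors_of_injective _ hRS le_rfl
  have hloc : IsLocalization (Algebra.algebraMapSubmonoid S (nonZeroDivisors R)) (S ⊗[R] K) :=
    inferInstance
  have hdom : IsDomain (S ⊗[R] K) := IsLocalization.isDomain_of_le_nonZeroDivisors (R := S) (S ⊗[R] K) hM
  have hdom' : IsDomain (K ⊗[R] S) := (Algebra.TensorProduct.comm R K S).toMulEquiv.isDomain _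
  have hfin : Module.Finite K (K ⊗[R] S) := Algebra.FormallyUnramified.finite_of_free K _
  have hf' : IsField (K ⊗[R] S) := isField_of_isIntegral_of_isField' (Field.toIsField K)
  have hf : IsField (S ⊗[R] K) := (Algebra.TensorProduct.comm R S K).toMulEquiv.isField hf'
  let := hf.toField
  have hfrac : IsFractionRing S (S ⊗[R] K) := by
    refine IsLocalization.of_le _ _ hM fun s hs ↦ isUnit_iff_ne_zero.mpr fun h ↦ ?_
    exact nonZeroDivisors.ne_zero hs (IsLocalization.injective (S ⊗[R] K) hM (by rw [h, map_zero]))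
  rw [isIntegrallyClosed_iff (S ⊗[R] K)]
  intro x hx
  obtain ⟨z, hz⟩ := (TensorProduct.toIntegralClosure_bijective_of_smooth (R := R) (S := S)
    (B := K)).2 ⟨x, hx⟩
  replace hz : (TensorProduct.toIntegralClosure R S K z : S ⊗[R] K) = x := congrArg Subtype.val hz
  rw [← hz]
  clear hz
  induction z with
  | zero => exact ⟨0, by simp⟩
  | add a b ha hb =>
    obtain ⟨s, hs⟩ := ha
    obtain ⟨t, ht⟩ := hb
    exact ⟨s + t, by simp [hs, ht]⟩
  | tmul s y =>
    obtain ⟨r, hr⟩ := IsIntegrallyClosed.isIntegral_iff.mp y.2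
    refine ⟨r • s, ?_⟩
    change (r • s) ⊗ₜ (1 : K) = s ⊗ₜ (y : K)
    rw [← hr, TensorProduct.smul_tmul, Algebra.smul_def, mul_one]

theorem exists_isIntegrallyClosed_localization_away (k A : Type*) [Field k] [PerfectField k]
    [CommRing A] [IsDomain A] [Algebra k A] [Algebra.FiniteType k A] :
    ∃ a : A, a ≠ 0 ∧ IsIntegrallyClosed (Localization.Away a) := by
  have hfr : IsFractionRing A (Localization.AtPrime (⊥ : Ideal A)) := by
    simpa [Ideal.primeCompl_bot] using Localization.isLocalization (M := (⊥ : Ideal A).primeCompl)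
  have hs : Algebra.IsSmoothAt k (⊥ : Ideal A) := by
    let := IsFractionRing.toField A (K := Localization.AtPrime (⊥ : Ideal A))
    have : Algebra.EssFiniteType k (Localization.AtPrime (⊥ : Ideal A)) := inferInstance
    exact Algebra.FormallySmooth.of_perfectField
  have : Algebra.FinitePresentation k A := Algebra.FinitePresentation.of_finiteType.mp inferInstance
  obtain ⟨a, ha, n, _, _, h⟩ := Algebra.IsSmoothAt.exists_isStandardEtale_mvPolynomial (R := k)
    (p := (⊥ : Ideal A))
  have ha0 : a ≠ 0 := by simpa using ha
  have : IsDomain (Localization.Away a) := IsLocalization.isDomain_localization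
    (powers_le_nonZeroDivisors_of_noZeroDivisors ha0)
  exact ⟨a, ha0, .of_etale (MvPolynomial (Fin n) k) (Localization.Away a)⟩

theorem MvPolynomial.isIntegrallyClosed_fin (R : Type*) [CommRing R] [IsDomain R]
    [IsIntegrallyClosed R] (n : ℕ) : IsIntegrallyClosed (MvPolynomial (Fin n) R) := by
  induction n with
  | zero => exact .of_equiv (MvPolynomial.isEmptyAlgEquiv R (Fin 0)).symm.toRingEquiv
  | succ n ih => exact .of_equiv (MvPolynomial.finSuccEquiv R n).symm.toRingEquiv

open Classical in
attribute [local instance] MvPolynomial.algebraMvPolynomial in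
/-- Generic Noether normalization, relative to a domain `A`. -/
theorem exists_algebraicIndependent_and_pow_smul_isIntegral (A B : Type u) [CommRing A] [IsDomain A]
    [CommRing B] [IsDomain B] [Algebra A B] [Algebra.FiniteType A B]
    (hAB : Function.Injective (algebraMap A B)) :
    ∃ (n : ℕ) (t : Fin n → B) (a : A), a ≠ 0 ∧ AlgebraicIndependent A t ∧
      ∀ b : B, ∃ N : ℕ,
        (MvPolynomial.aeval t : MvPolynomial (Fin n) A →ₐ[A] B).toRingHom.IsIntegralElem
          (a ^ N • b) := by
  let K := FractionRing A
  let S := Algebra.algebraMapSubmonoid B (nonZeroDivisors A)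
  have hS : S ≤ nonZeroDivisors B := map_le_nonZeroDivisors_of_injective _ hAB le_rfl
  let B' := Localization S
  have : IsDomain B' := IsLocalization.isDomain_localization hS
  let : Algebra K B' := localizationAlgebra (nonZeroDivisors A) B
  have : IsScalarTower A K B' := isScalarTower_localizationAlgebra (nonZeroDivisors A) B
  have hBB' : Function.Injective (algebraMap B B') := IsLocalization.injective B' hS
  have : Algebra.FiniteType K B' := by
    have h : (algebraMap A B).FiniteType := RingHom.finiteType_algebraMap.mpr inferInstance
    have : IsLocalization ((nonZeroDivisors A).map (algebraMap A B)) B' :=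
      inferInstanceAs (IsLocalization S B')
    exact RingHom.finiteType_localizationPreserves (algebraMap A B) (nonZeroDivisors A) K B' h
  obtain ⟨n, g, hg, hgi⟩ := exists_integral_inj_algHom_of_fg K B'
  obtain ⟨⟨_, s, hs, rfl⟩, hst⟩ :=
    IsLocalization.exist_integer_multiples_of_finite S fun i ↦ g (MvPolynomial.X i)
  choose t ht using hst
  have hs0 : s ≠ 0 := nonZeroDivisors.ne_zero hs
  obtain ⟨u, hu⟩ : ∃ u : K, u = algebraMap A K s := ⟨_, rfl⟩
  have hu0 : u ≠ 0 := by simpa [hu] using hs0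
  have ht' (i : Fin n) : algebraMap B B' (t i) = g (u • MvPolynomial.X i) := by
    rw [ht, map_smul, hu, algebraMap_smul, algebraMap_smul]
  let σ : MvPolynomial (Fin n) K →ₐ[K] MvPolynomial (Fin n) K :=
    MvPolynomial.aeval fun i ↦ u • MvPolynomial.X i
  let τ : MvPolynomial (Fin n) K →ₐ[K] MvPolynomial (Fin n) K :=
    MvPolynomial.aeval fun i ↦ u⁻¹ • MvPolynomial.X i
  have hστ : σ.comp τ = .id K _ := by
    ext i : 1
    simp [σ, τ, smul_smul, inv_mul_cancel₀ hu0]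
  have hτσ : τ.comp σ = .id K _ := by
    ext i : 1
    simp [σ, τ, smul_smul, mul_inv_cancel₀ hu0]
  let e := AlgEquiv.ofAlgHom σ τ hστ hτσ
  let g' : MvPolynomial (Fin n) K →ₐ[K] B' := g.comp e.toAlgHom
  have hg' : g' = MvPolynomial.aeval (fun i ↦ algebraMap B B' (t i)) := by
    ext i
    simp [g', e, σ, ht']
  have hg'inj : Function.Injective g' := hg.comp e.injective
  have hg'int : g'.toRingHom.IsIntegral :=
    (RingHom.isIntegral_of_surjective e.toAlgHom.toRingHom e.surjective).trans _ _ hgi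
  let R := MvPolynomial (Fin n) A
  let : Algebra R B := (MvPolynomial.aeval t).toAlgebra
  let : Algebra (MvPolynomial (Fin n) K) B' := g'.toAlgebra
  have hcomm : (algebraMap B B').comp (algebraMap R B) = (algebraMap (MvPolynomial (Fin n) K) B').comp
      (MvPolynomial.map (algebraMap A K)) := by
    ext i
    · change algebraMap B B' (MvPolynomial.aeval t (MvPolynomial.C i)) =
        g' (MvPolynomial.map (algebraMap A K) (MvPolynomial.C i))
      rw [MvPolynomial.map_C, hg', MvPolynomial.aeval_C, MvPolynomial.aeval_C,
        ← IsScalarTower.algebraMap_apply, ← IsScalarTower.algebraMap_apply]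
    · change algebraMap B B' (MvPolynomial.aeval t (MvPolynomial.X i)) =
        g' (MvPolynomial.map (algebraMap A K) (MvPolynomial.X i))
      rw [MvPolynomial.map_X, hg', MvPolynomial.aeval_X, MvPolynomial.aeval_X]
  have : IsScalarTower R (MvPolynomial (Fin n) K) B' := .of_algebraMap_eq' hcomm
  have hind : AlgebraicIndependent A t := by
    have : Function.Injective ((algebraMap B B').comp (algebraMap R B)) := by
      rw [hcomm]
      exact hg'inj.comp (MvPolynomial.map_injective _ (IsFractionRing.injective A K))
    rw [RingHom.coe_comp] at this
    exact this.of_comp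
  have key (b : B) : ∃ c : A, c ≠ 0 ∧ IsIntegral R (c • b) := by
    obtain ⟨⟨_, c, hc, rfl⟩, h⟩ := IsIntegral.exists_multiple_integral_of_isLocalization
      (R := R) (Rₘ := MvPolynomial (Fin n) K) ((nonZeroDivisors A).map MvPolynomial.C)
      (algebraMap B B' b) (hg'int _)
    refine ⟨c, nonZeroDivisors.ne_zero hc, (isIntegral_algebraMap_iff hBB').mp ?_⟩
    have h' : algebraMap B B' (c • b) = MvPolynomial.C (σ := Fin n) c • algebraMap B B' b := by
      rw [Algebra.smul_def, Algebra.smul_def, map_mul]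
      congr 1
      change _ = algebraMap B B' (MvPolynomial.aeval t (MvPolynomial.C c))
      rw [MvPolynomial.aeval_C]
    rw [h']
    exact h
  choose c hc0 hc using key
  obtain ⟨G, hG⟩ := (‹Algebra.FiniteType A B›).out
  have hR (x : A) : IsIntegral R (algebraMap A B x) := by
    have h : IsIntegral R (algebraMap R B (MvPolynomial.C x)) := isIntegral_algebraMap
    rwa [show algebraMap R B (MvPolynomial.C x) = algebraMap A B x from
      MvPolynomial.aeval_C t x] at h
  refine ⟨n, t, ∏ b ∈ G, c b, Finset.prod_ne_zero_iff.mpr fun b _ ↦ hc0 b, hind, fun b ↦ ?_⟩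
  change ∃ N : ℕ, IsIntegral R _
  have hb : b ∈ Algebra.adjoin A (G : Set B) := hG ▸ trivial
  induction hb using Algebra.adjoin_induction with
  | mem x hx =>
    refine ⟨1, ?_⟩
    rw [pow_one, ← Finset.prod_erase_mul _ _ hx, mul_smul, Algebra.smul_def]
    exact (hR _).mul (hc x)
  | algebraMap r => exact ⟨0, by simpa using hR r⟩
  | add x y _ _ hx hy =>
    obtain ⟨i, hi⟩ := hx
    obtain ⟨j, hj⟩ := hy
    refine ⟨i + j, ?_⟩
    have h1 := ((hR ((∏ b ∈ G, c b) ^ j)).mul hi).add ((hR ((∏ b ∈ G, c b) ^ i)).mul hj)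
    rwa [← Algebra.smul_def, ← Algebra.smul_def, smul_smul, smul_smul, ← pow_add, ← pow_add,
      add_comm j i, ← smul_add] at h1
  | mul x y _ _ hx hy =>
    obtain ⟨i, hi⟩ := hx
    obtain ⟨j, hj⟩ := hy
    refine ⟨i + j, ?_⟩
    have h1 := hi.mul hj
    rwa [smul_mul_smul_comm, ← pow_add] at h1

theorem Algebra.HasGoingDown.and_exists_under_eq_of_normalization
    {A A' B' : Type*} [CommRing A] [CommRing A'] [IsDomain A'] [IsIntegrallyClosed A']
    [CommRing B'] [IsDomain B'] [Algebra A A'] [Algebra A' B'] [Algebra A B']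
    [IsScalarTower A A' B'] (a : A) [IsLocalization.Away a A'] {n : ℕ} {t : Fin n → B'}
    (ht : AlgebraicIndependent A' t)
    (hint : (MvPolynomial.aeval t : MvPolynomial (Fin n) A' →ₐ[A'] B').toRingHom.IsIntegral) :
    Algebra.HasGoingDown A B' ∧
      ∀ p : Ideal A, p.IsPrime → a ∉ p → ∃ Q : Ideal B', Q.IsPrime ∧ Q.under A = p := by
  have := MvPolynomial.isIntegrallyClosed_fin A' n
  let : Algebra (MvPolynomial (Fin n) A') B' := (MvPolynomial.aeval t).toAlgebra
  have : IsScalarTower A' (MvPolynomial (Fin n) A') B' :=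
    .of_algebraMap_eq fun x ↦ (MvPolynomial.aeval_C _ x).symm
  have : IsScalarTower A (MvPolynomial (Fin n) A') B' := .of_algebraMap_eq fun x ↦ by
    rw [IsScalarTower.algebraMap_apply A A' B',
      IsScalarTower.algebraMap_apply A' (MvPolynomial (Fin n) A') B',
      IsScalarTower.algebraMap_apply A A' (MvPolynomial (Fin n) A')]
  have hinj : Function.Injective (algebraMap (MvPolynomial (Fin n) A') B') := ht
  have : FaithfulSMul (MvPolynomial (Fin n) A') B' :=
    (faithfulSMul_iff_algebraMap_injective _ _).mpr hinj
  have : Algebra.IsIntegral (MvPolynomial (Fin n) A') B' := ⟨hint⟩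
  have : Module.Flat A A' := IsLocalization.flat A' (.powers a)
  have : Algebra.HasGoingDown A (MvPolynomial (Fin n) A') := .trans A A' _
  refine ⟨.trans A (MvPolynomial (Fin n) A') B', fun p hp hap ↦ ?_⟩
  have hdisj : Disjoint (Submonoid.powers a : Set A) p :=
    (Ideal.disjoint_powers_iff_notMem_of_isPrime _).mpr hap
  have hp' : (p.map (algebraMap A A')).IsPrime :=
    IsLocalization.isPrime_of_isPrime_disjoint _ A' p hp hdisj
  have hpp' : (p.map (algebraMap A A')).under A = p :=
    IsLocalization.under_map_of_isPrime_disjoint _ A' hp hdisj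
  obtain ⟨Q, hQ, hQo⟩ := Ideal.exists_ideal_over_prime_of_isIntegral_of_isDomain (S := B')
    ((p.map (algebraMap A A')).comap (MvPolynomial.constantCoeff (σ := Fin n)))
    (by rw [(RingHom.injective_iff_ker_eq_bot _).mp hinj]; exact bot_le)
  refine ⟨Q, hQ, ?_⟩
  rw [← Ideal.under_under (B := MvPolynomial (Fin n) A'), Ideal.under_def (MvPolynomial (Fin n) A'),
    hQo, ← Ideal.under_under (B := A')]
  convert hpp'
  ext x
  change MvPolynomial.constantCoeff (MvPolynomial.C x) ∈ p.map (algebraMap A A') ↔ _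
  rw [MvPolynomial.constantCoeff_C]

theorem Algebra.HasGoingDown.exists_le_under_eq_of_localization {A B B' : Type*} [CommRing A]
    [CommRing B] [CommRing B'] [Algebra A B] [Algebra B B'] [Algebra A B'] [IsScalarTower A B B']
    [Algebra.HasGoingDown A B'] (M : Submonoid B) [IsLocalization M B'] {P : Ideal B} [hP : P.IsPrime]
    (hdisj : Disjoint (M : Set B) P) {p : Ideal A} [p.IsPrime] (hpP : p ≤ P.under A) :
    ∃ Q ≤ P, Q.IsPrime ∧ Q.under A = p := by
  have hP' : (P.map (algebraMap B B')).IsPrime :=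
    IsLocalization.isPrime_of_isPrime_disjoint _ B' P hP hdisj
  have hPP' : (P.map (algebraMap B B')).under B = P :=
    IsLocalization.under_map_of_isPrime_disjoint _ B' hP hdisj
  have hover : (P.map (algebraMap B B')).LiesOver (P.under A) := ⟨by
    rw [← Ideal.under_under (B := B) (P.map (algebraMap B B')), hPP']⟩
  obtain ⟨Q, hQ, hQp, hQo⟩ := Ideal.exists_ideal_le_liesOver_of_le (P.map (algebraMap B B')) hpP
  refine ⟨Q.under B, (Ideal.comap_mono hQ).trans_eq hPP', inferInstance, ?_⟩
  rw [Ideal.under_under, ← hQo.over]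

theorem exists_isIntegral_away_of_pow_smul {A A' B B' : Type*} [CommRing A] [CommRing A']
    [CommRing B] [CommRing B'] [Algebra A A'] [Algebra A B] [Algebra A B'] [Algebra A' B'] [Algebra B B']
    [IsScalarTower A A' B'] [IsScalarTower A B B'] {a c : A} (hca : c ∣ a) 
    [IsLocalization.Away a A'] [IsLocalization.Away (algebraMap A B a) B'] {n : ℕ} {t : Fin n → B}
    (hN : ∀ b : B, ∃ N : ℕ, (MvPolynomial.aeval t : MvPolynomial (Fin n) A →ₐ[A] B).toRingHom.IsIntegralElem
          (c ^ N • b)) :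
    (MvPolynomial.aeval (fun i ↦ algebraMap B B' (t i)) : 
      MvPolynomial (Fin n) A' →ₐ[A'] B').toRingHom.IsIntegral := by
  let : Algebra (MvPolynomial (Fin n) A) B := (MvPolynomial.aeval t).toAlgebra
  let : Algebra (MvPolynomial (Fin n) A') B' :=
    (MvPolynomial.aeval (fun i ↦ algebraMap B B' (t i))).toAlgebra
  have hA' (x : A') : IsIntegral (MvPolynomial (Fin n) A') (algebraMap A' B' x) := by
    have h : IsIntegral (MvPolynomial (Fin n) A')
      (algebraMap (MvPolynomial (Fin n) A') B' (MvPolynomial.C x)) := isIntegral_algebraMap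
    rwa [show algebraMap (MvPolynomial (Fin n) A') B' (MvPolynomial.C x) = algebraMap A' B' x from
      MvPolynomial.aeval_C _ x] at h
  have ha : IsUnit (algebraMap A A' a) := IsLocalization.Away.algebraMap_isUnit a
  obtain ⟨v, hv⟩ := isUnit_of_dvd_unit (map_dvd (algebraMap A A') hca) ha
  obtain ⟨w, hw⟩ := ha
  have hB (b : B) : IsIntegral (MvPolynomial (Fin n) A') (algebraMap B B' b) := by
    obtain ⟨N, hb⟩ := hN b
    have h : IsIntegral (MvPolynomial (Fin n) A') (algebraMap B B' (c ^ N • b)) := by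
      refine IsIntegral.map_of_comp_eq (MvPolynomial.map (algebraMap A A')) (algebraMap B B') ?_ hb
      ext i
      · change MvPolynomial.aeval _ (MvPolynomial.map (algebraMap A A') (MvPolynomial.C i)) =
          algebraMap B B' (MvPolynomial.aeval t (MvPolynomial.C i))
        rw [MvPolynomial.map_C, MvPolynomial.aeval_C, MvPolynomial.aeval_C,
          ← IsScalarTower.algebraMap_apply, ← IsScalarTower.algebraMap_apply]
      · change MvPolynomial.aeval _ (MvPolynomial.map (algebraMap A A') (MvPolynomial.X i)) =
          algebraMap B B' (MvPolynomial.aeval t (MvPolynomial.X i))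
        rw [MvPolynomial.map_X, MvPolynomial.aeval_X, MvPolynomial.aeval_X]
    have h2 := (hA' ((v⁻¹ : A'ˣ) ^ N : A')).mul h
    rwa [Algebra.smul_def, map_mul, ← IsScalarTower.algebraMap_apply, 
      IsScalarTower.algebraMap_apply A A' B', map_pow (algebraMap A A'), ← hv, ← mul_assoc,
      ← map_mul, ← mul_pow, Units.inv_mul, one_pow, map_one, one_mul] at h2
  intro x
  obtain ⟨⟨b, _, m, rfl⟩, hx⟩ := IsLocalization.surj (.powers (algebraMap A B a)) x
  replace hx : x * algebraMap B B' (algebraMap A B a ^ m) = algebraMap B B' b := hx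
  have h := (hA' ((w⁻¹ : A'ˣ) ^ m : A')).mul (hB b)
  rwa [← hx, mul_comm x, map_pow (algebraMap B B'), ← IsScalarTower.algebraMap_apply, 
      IsScalarTower.algebraMap_apply A A' B', ← hw, ← mul_assoc,  ← map_pow (algebraMap A' B'),
      ← map_mul, ← mul_pow, Units.inv_mul, one_pow, map_one, one_mul] at h

theorem AlgebraicIndependent.of_localization_away {A A' B B' : Type*} [CommRing A] [CommRing A']
    [CommRing B] [CommRing B'] [Algebra A A'] [Algebra A B] [Algebra A B'] [Algebra A' B'] [Algebra B B']
    [IsScalarTower A A' B'] [IsScalarTower A B B'] (M : Submonoid A)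
    [IsLocalization M A'] (hinj : Function.Injective (algebraMap B B')) {n : ℕ} {t : Fin n → B}
    (ht : AlgebraicIndependent A t) : AlgebraicIndependent A' (fun i ↦ algebraMap B B' (t i)) := by
  let := MvPolynomial.algebraMvPolynomial (R := A) (S := A') (σ := Fin n)
  refine (injective_iff_map_eq_zero
    (MvPolynomial.aeval fun i ↦ algebraMap B B' (t i) : MvPolynomial (Fin n) A' →ₐ[A'] B')).mpr
    fun f hf ↦ ?_
  obtain ⟨g, ⟨_, m, hm, rfl⟩, rfl⟩ :=
    IsLocalization.exists_mk'_eq (M.map (MvPolynomial.C (σ := Fin n))) f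
  have hcomm (q : MvPolynomial (Fin n) A) :
      MvPolynomial.aeval (fun i ↦ algebraMap B B' (t i)) (MvPolynomial.map (algebraMap A A') q) =
        algebraMap B B' (MvPolynomial.aeval t q) := by
    rw [MvPolynomial.aeval_map_algebraMap]
    exact MvPolynomial.aeval_algebraMap_apply B' t q
  have h := congrArg (MvPolynomial.aeval (R := A') fun i ↦ algebraMap B B' (t i))
    (IsLocalization.mk'_spec (MvPolynomial (Fin n) A') g
      (⟨_, m, hm, rfl⟩ : M.map (MvPolynomial.C (σ := Fin n))))
  rw [map_mul, hf, zero_mul, MvPolynomial.algebraMap_def, hcomm] at h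
  have hg : g = 0 := ht (by rw [map_zero]; exact hinj (by rw [← h, map_zero]))
  rw [hg, IsLocalization.mk'_zero]

/-- Generically on the base, primes can be generalized along `A → B`, and the fibres are
nonempty. -/
theorem exists_forall_exists_le_under_eq (k A B : Type u) [Field k] [PerfectField k]
    [CommRing A] [IsDomain A] [CommRing B] [IsDomain B] [Algebra k A] [Algebra.FiniteType k A]
    [Algebra A B] [Algebra.FiniteType A B] (hAB : Function.Injective (algebraMap A B)) :
    ∃ a : A, a ≠ 0 ∧
      (∀ P : Ideal B, P.IsPrime → algebraMap A B a ∉ P → ∀ p : Ideal A, p.IsPrime →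
        p ≤ P.under A → ∃ Q ≤ P, Q.IsPrime ∧ Q.under A = p) ∧
      ∀ p : Ideal A, p.IsPrime → a ∉ p → ∃ Q : Ideal B, Q.IsPrime ∧ Q.under A = p := by
  obtain ⟨a₀, ha₀, hint⟩ := exists_isIntegrallyClosed_localization_away k A
  obtain ⟨n, t, c, hc, ht, hN⟩ := exists_algebraicIndependent_and_pow_smul_isIntegral A B hAB
  let A₀ := Localization.Away a₀
  have : IsDomain A₀ := IsLocalization.isDomain_localization
    (powers_le_nonZeroDivisors_of_noZeroDivisors ha₀)
  have hc₀ : algebraMap A A₀ c ≠ 0 := by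
    rwa [Ne, map_eq_zero_iff _ (IsLocalization.injective A₀
      (powers_le_nonZeroDivisors_of_noZeroDivisors ha₀))]
  let A' := Localization.Away (algebraMap A A₀ c)
  have : IsDomain A' := IsLocalization.isDomain_localization
    (powers_le_nonZeroDivisors_of_noZeroDivisors hc₀)
  have : IsIntegrallyClosed A' := isIntegrallyClosed_of_isLocalization A' _
    (powers_le_nonZeroDivisors_of_noZeroDivisors hc₀)
  let a := a₀ * c
  have ha : a ≠ 0 := mul_ne_zero ha₀ hc
  have hloc : IsLocalization.Away a A' := IsLocalization.Away.mul' A₀ A' a₀ c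
  have hab : algebraMap A B a ≠ 0 := by rwa [Ne, map_eq_zero_iff _ hAB]
  let B' := Localization.Away (algebraMap A B a)
  have : IsDomain B' := IsLocalization.isDomain_localization
    (powers_le_nonZeroDivisors_of_noZeroDivisors hab)
  have hBB' : Function.Injective (algebraMap B B') := IsLocalization.injective B'
    (powers_le_nonZeroDivisors_of_noZeroDivisors hab)
  let φ : A' →+* B' := IsLocalization.Away.lift a (g := algebraMap A B') (by
    rw [IsScalarTower.algebraMap_apply A B B']
    exact IsLocalization.Away.algebraMap_isUnit _)
  let : Algebra A' B' := φ.toAlgebra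
  have : IsScalarTower A A' B' := IsScalarTower.of_algebraMap_eq (R := A) (S := A') (A := B')
    fun x ↦ (IsLocalization.Away.lift_eq a _ x).symm
  obtain ⟨h1, h2⟩ := Algebra.HasGoingDown.and_exists_under_eq_of_normalization (A := A) (A' := A')
    (B' := B') a (ht.of_localization_away (.powers a) hBB')
    (exists_isIntegral_away_of_pow_smul (Dvd.intro_left a₀ rfl) hN)
  refine ⟨a, ha, fun P hP haP p hp hpP ↦ ?_, fun p hp hap ↦ ?_⟩
  · exact Algebra.HasGoingDown.exists_le_under_eq_of_localization (B' := B')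
      (.powers (algebraMap A B a)) ((Ideal.disjoint_powers_iff_notMem_of_isPrime _).mpr haP) hpP
  · obtain ⟨Q, hQ, hQp⟩ := h2 p hp hap
    exact ⟨Q.under B, inferInstance, by rw [Ideal.under_under, hQp]⟩

/-- If primes can be generalized along `A → B` below `P`, and `P` is minimal in its fibre, then
`P` has the height of the prime below it. -/
theorem Ideal.height_eq_height_under_of_forall_exists_le {A B : Type*} [CommRing A] [CommRing B]
    [Algebra A B] [IsNoetherianRing A] [IsNoetherianRing B] (P : Ideal B) [hP : P.IsPrime]
    (H : ∀ Q ≤ P, Q.IsPrime → ∀ p : Ideal A, p.IsPrime → p ≤ Q.under A →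
      ∃ Q' ≤ Q, Q'.IsPrime ∧ Q'.under A = p)
    (hmin : P ∈ ((P.under A).map (algebraMap A B)).minimalPrimes) :
    P.height = (P.under A).height := by
  let S := Localization.AtPrime P
  have hgd : Algebra.HasGoingDown A S := by
    refine ⟨fun {p} hp Q hQ hpQ ↦ ?_⟩
    have hQP : Q.under B ≤ P := by
      exact (Ideal.comap_mono (IsLocalRing.le_maximalIdeal hQ.ne_top)).trans_eq
        Localization.AtPrime.under_maximalIdeal
    obtain ⟨Q', hQ', hp', hu⟩ := H (Q.under B) hQP inferInstance p hp
      (by rw [Ideal.under_under]; exact hpQ.le)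
    have hdisj : Disjoint (P.primeCompl : Set B) Q' :=
      Set.disjoint_left.mpr fun x hx hxQ ↦ hx (hQP (hQ' hxQ))
    have hpr := IsLocalization.isPrime_of_isPrime_disjoint P.primeCompl S Q' hp' hdisj
    refine ⟨Q'.map (algebraMap B S), Ideal.map_le_iff_le_comap.mpr hQ', hpr, ⟨?_⟩⟩
    rw [← Ideal.under_under (B := B),
      IsLocalization.under_map_of_isPrime_disjoint P.primeCompl S hp' hdisj, hu]
  have hover : (IsLocalRing.maximalIdeal S).under B = P := Localization.AtPrime.under_maximalIdeal
  have hlo : (IsLocalRing.maximalIdeal S).LiesOver (P.under A) := ⟨by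
    rw [← Ideal.under_under (B := B) (IsLocalRing.maximalIdeal S), hover]⟩
  have hnoeth : IsNoetherianRing S := IsLocalization.isNoetherianRing P.primeCompl S inferInstance
  have h := Ideal.height_eq_of_mem_minimalPrimes_map (P.under A) (IsLocalRing.maximalIdeal S) (by
    refine ⟨⟨inferInstance, ?_⟩, fun Q hQ _ ↦ ?_⟩
    · rw [Ideal.map_le_iff_le_comap, ← Ideal.under_def, ← hlo.over]
    · have hQ1 := hQ.1
      have h1 : P ≤ Q.under B := hmin.2 ⟨inferInstance, by
        rw [Ideal.map_le_iff_le_comap, ← Ideal.under_def, Ideal.under_under]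
        exact Ideal.map_le_iff_le_comap.mp hQ.2⟩ (by
          conv_rhs => rw [← hover]
          exact Ideal.comap_mono (IsLocalRing.le_maximalIdeal hQ1.ne_top))
      rw [← Localization.AtPrime.map_eq_maximalIdeal]
      exact Ideal.map_le_iff_le_comap.mpr h1)
  rw [← h, ← IsLocalization.height_under P.primeCompl (IsLocalRing.maximalIdeal S), hover]

theorem topologicalKrullDim_eq_krullDim (X : Scheme.{u}) :
    topologicalKrullDim X = Order.krullDim X :=
  Order.krullDim_eq_of_orderIso (irreducibleSetEquivPoints (α := X))

theorem codimension_eq_coheight {X : Scheme.{u}} {Z : IrreducibleCloseds X} {z : X}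
    (hz : (Z : Set X) = closure {z}) : codimension Z = Order.coheight z := by
  have h := Order.coheight_orderIso (irreducibleSetEquivPoints (α := X)).symm z
  rw [← h]
  exact congrArg Order.coheight (IrreducibleCloseds.ext hz)

theorem topologicalKrullDim_eq_height {X : Scheme.{u}} {Z : IrreducibleCloseds X} {z : X}
    (hz : (Z : Set X) = closure {z}) : topologicalKrullDim (Z : Set X) = Order.height z := by
  have hmem (y : X) : y ∈ (Z : Set X) ↔ y ≤ z := by
    rw [hz, ← specializes_iff_mem_closure]; rfl
  have hemb : Topology.IsClosedEmbedding (Subtype.val : ↥(Z : Set X) → X) :=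
    Z.isClosed.isClosedEmbedding_subtypeVal
  have := hemb.quasiSober
  let e : @OrderIso ↥(Z : Set X) (Set.Iic z) (specializationOrder _).toLE _ :=
    @RelIso.mk ↥(Z : Set X) (Set.Iic z) (specializationOrder _).le (· ≤ ·)
      (Equiv.subtypeEquivRight hmem)
      fun {a b} ↦ (hemb.isInducing.specializes_iff (x := b) (y := a))
  rw [Order.height_eq_krullDim_Iic]
  exact Order.krullDim_eq_of_orderIso
    (@OrderIso.trans _ _ _ _ (specializationOrder _).toLE _ irreducibleSetEquivPoints e)

theorem AlgebraicGeometry.height_eq_ringKrullDim_quotient {R : CommRingCat.{u}} (x : Spec R) :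
    (Order.height x : WithBot ℕ∞) = ringKrullDim (R ⧸ x.asIdeal) := by
  rw [ringKrullDim_quotient, ← Order.height_orderIso (specOrderIsoPrimeSpectrum R) x]
  exact Order.coheight_eq_krullDim_Ici (show PrimeSpectrum R from x)

namespace AlgebraicGeometry

/-- The ring homomorphism from the base field to the sections of a scheme. -/
noncomputable def Scheme.Hom.fieldToSections {k : Type u} [Field k] {X : Scheme.{u}}
    (s : X ⟶ Spec (.of k)) (V : X.Opens) : k →+* Γ(X, V) :=
  ((Scheme.ΓSpecIso (.of k)).inv ≫ s.appLE ⊤ V (show V ≤ s ⁻¹ᵁ ⊤ from le_top)).hom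

theorem Scheme.Hom.finiteType_fieldToSections {k : Type u} [Field k] {X : Scheme.{u}}
    (s : X ⟶ Spec (.of k)) [LocallyOfFiniteType s] {V : X.Opens} (hV : IsAffineOpen V) :
    (s.fieldToSections V).FiniteType := by
  have h := s.finiteType_appLE (isAffineOpen_top _) hV le_top
  rw [fieldToSections, CommRingCat.hom_comp]
  exact RingHom.FiniteType.comp h (.of_surjective _ (ConcreteCategory.bijective_of_isIso (Scheme.ΓSpecIso (.of k)).inv).2)

theorem Scheme.Hom.map_comp_fieldToSections {k : Type u} [Field k] {X : Scheme.{u}}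
    (s : X ⟶ Spec (.of k)) {V W : X.Opens} (i : W ⟶ V) :
    (X.presheaf.map i.op).hom.comp (s.fieldToSections V) = s.fieldToSections W := by
  rw [fieldToSections, fieldToSections, ← CommRingCat.hom_comp, Category.assoc, Scheme.Hom.appLE_map]

theorem Scheme.Hom.appLE_comp_fieldToSections {k : Type u} [Field k] {X Y : Scheme.{u}}
    (s : Y ⟶ Spec (.of k)) (f : X ⟶ Y) {V : Y.Opens} {W : X.Opens} (i : W ≤ f ⁻¹ᵁ V) :
    (f.appLE V W i).hom.comp (s.fieldToSections V) = (f ≫ s).fieldToSections W := by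
  rw [fieldToSections, fieldToSections, ← CommRingCat.hom_comp, Category.assoc,
    Scheme.Hom.appLE_comp_appLE]

theorem exists_ringKrullDim_sections_eq {k : Type u} [Field k] {X : Scheme.{u}} [IsIntegral X]
    (s : X ⟶ Spec (.of k)) [LocallyOfFiniteType s] :
    ∃ d : ℕ, ∀ V : X.Opens, IsAffineOpen V → (V : Set X).Nonempty → ringKrullDim Γ(X, V) = d := by
  have : Nonempty (⊤ : X.Opens) := ⟨⟨genericPoint X, trivial⟩⟩
  let κ : k →+* X.functionField := (X.germToFunctionField ⊤).hom.comp (s.fieldToSections ⊤)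
  let := κ.toAlgebra
  have key (V : X.Opens) (hV : IsAffineOpen V) (hne : (V : Set X).Nonempty) :
      ∃ n : ℕ, ringKrullDim Γ(X, V) = n ∧ Algebra.trdeg k X.functionField = n := by
    have : Nonempty V := hne.to_subtype
    let := (s.fieldToSections V).toAlgebra
    have : Algebra.FiniteType k Γ(X, V) := s.finiteType_fieldToSections hV
    obtain ⟨n, hn, hd, -⟩ := exists_ringKrullDim_eq_trdeg k Γ(X, V)
    have := functionField_isFractionRing_of_isAffineOpen X V hV
    have : IsScalarTower k Γ(X, V) X.functionField := .of_algebraMap_eq' (by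
      change κ = (X.germToFunctionField V).hom.comp (s.fieldToSections V)
      rw [← s.map_comp_fieldToSections (V := ⊤) (homOfLE le_top), ← RingHom.comp_assoc,
        ← CommRingCat.hom_comp, TopCat.Presheaf.germ_res])
    have : Algebra.IsAlgebraic Γ(X, V) X.functionField :=
      IsLocalization.isAlgebraic _ (nonZeroDivisors Γ(X, V))
    have h := trdeg_add_eq k Γ(X, V) (A := X.functionField)
    rw [trdeg_eq_zero (R := Γ(X, V)) (A := X.functionField), add_zero, hn] at h
    exact ⟨n, hd, h.symm⟩
  obtain ⟨V, hV, hx, -⟩ := exists_isAffineOpen_mem_and_subset (U := ⊤) (x := genericPoint X) trivial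
  obtain ⟨n, -, hn⟩ := key V hV ⟨_, hx⟩
  refine ⟨n, fun W hW hne ↦ ?_⟩
  obtain ⟨m, hm, hm'⟩ := key W hW hne
  rw [hm, show m = n by exact_mod_cast hm'.symm.trans hn]

theorem exists_height_add_coheight_eq {k : Type u} [Field k] {X : Scheme.{u}} [IsIntegral X]
    (s : X ⟶ Spec (.of k)) [LocallyOfFiniteType s] :
    ∃ d : ℕ, topologicalKrullDim X = d ∧
      (∀ V : X.Opens, IsAffineOpen V → (V : Set X).Nonempty → ringKrullDim Γ(X, V) = d) ∧
      ∀ x : X, Order.height x + Order.coheight x = d := by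
  obtain ⟨d, hd⟩ := exists_ringKrullDim_sections_eq s
  have key (x : X) : Order.coheight x ≤ d ∧ d ≤ Order.height x + Order.coheight x := by
    obtain ⟨V, hV, hx, -⟩ := exists_isAffineOpen_mem_and_subset (U := ⊤) (x := x) trivial
    have : Nonempty V := ⟨⟨x, hx⟩⟩
    obtain ⟨y, rfl⟩ : x ∈ Set.range hV.fromSpec := by rwa [hV.range_fromSpec]
    let := (s.fieldToSections V).toAlgebra
    have : Algebra.FiniteType k Γ(X, V) := s.finiteType_fieldToSections hV
    have : y.asIdeal.IsPrime := y.2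
    have h := Ideal.height_add_ringKrullDim_quotient k Γ(X, V) y.asIdeal
    have hco : Order.coheight (hV.fromSpec y) = y.asIdeal.height := by
      rw [idealHeight_eq_coheight]; exact coheight_eq_of_isOpenImmersion hV.fromSpec
    have hhe : Order.height y ≤ Order.height (hV.fromSpec y) := by
      have hind := hV.fromSpec.isOpenEmbedding.isInducing
      refine Order.height_le_height_apply_of_strictMono (fun y ↦ hV.fromSpec y)
        (fun a b h ↦ ?_) y
      rw [lt_iff_le_not_ge] at h ⊢
      exact ⟨(hind.specializes_iff (x := b) (y := a)).mpr h.1,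
        fun h' ↦ h.2 ((hind.specializes_iff (x := a) (y := b)).mp h')⟩
    rw [hd V hV ⟨_, hx⟩, ← AlgebraicGeometry.height_eq_ringKrullDim_quotient] at h
    rw [hco]
    constructor
    · have := Ideal.height_le_ringKrullDim_of_ne_top y.2.ne_top
      rw [hd V hV ⟨_, hx⟩] at this
      exact_mod_cast this
    · have h' : y.asIdeal.height + Order.height y = d := by exact_mod_cast h
      rw [← h', add_comm]
      gcongr
  have hX : Order.krullDim X = ↑(⨆ x : X, Order.coheight x) := Order.krullDim_eq_iSup_coheight_of_nonempty
  have hle : ⨆ x : X, Order.coheight x ≤ (d : ℕ∞) := iSup_le fun x ↦ (key x).1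
  have hsum (x : X) : Order.height x + Order.coheight x ≤ ⨆ x : X, Order.coheight x := by
    have h := Order.krullDim_eq_iSup_height_add_coheight_of_nonempty (α := X)
    rw [hX] at h
    rw [WithBot.coe_injective h]
    exact le_iSup (fun x : X ↦ Order.height x + Order.coheight x) x
  refine ⟨d, ?_, hd, fun x ↦ le_antisymm ((hsum x).trans hle) (key x).2⟩
  rw [topologicalKrullDim_eq_krullDim, hX]
  have h := (key (genericPoint X)).2.trans (hsum _)
  rw [le_antisymm hle h]; rfl

theorem IsAffineOpen.fromSpec_specializes_iff {X : Scheme.{u}} {V : X.Opens} (hV : IsAffineOpen V)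
    {y y' : PrimeSpectrum Γ(X, V)} :
    hV.fromSpec y ⤳ hV.fromSpec y' ↔ y.asIdeal ≤ y'.asIdeal :=
  (hV.fromSpec.isOpenEmbedding.isInducing.specializes_iff).trans
    (PrimeSpectrum.le_iff_specializes y y').symm

theorem IsAffineOpen.exists_fromSpec_eq {X : Scheme.{u}} {V : X.Opens} (hV : IsAffineOpen V) {x : X}
    (hx : x ∈ V) : ∃ y : PrimeSpectrum Γ(X, V), hV.fromSpec y = x := by
  have : x ∈ Set.range hV.fromSpec := by rwa [hV.range_fromSpec]
  exact this

theorem IsAffineOpen.fromSpec_mem_basicOpen {X : Scheme.{u}} {V : X.Opens} (hV : IsAffineOpen V)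
    {y : PrimeSpectrum Γ(X, V)} {a : Γ(X, V)} :
    hV.fromSpec y ∈ X.basicOpen a ↔ a ∉ y.asIdeal := by
  rw [← PrimeSpectrum.mem_basicOpen, ← hV.fromSpec_preimage_basicOpen]
  rfl

theorem IsAffineOpen.apply_fromSpec {X Y : Scheme.{u}} (f : X ⟶ Y) {V : Y.Opens} {W : X.Opens}
    (hV : IsAffineOpen V) (hW : IsAffineOpen W) (i : W ≤ f ⁻¹ᵁ V) (y : PrimeSpectrum Γ(X, W)) :
    f (hW.fromSpec y) = hV.fromSpec (PrimeSpectrum.comap (f.appLE V W i).hom y) :=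
  congr($(IsAffineOpen.SpecMap_appLE_fromSpec f hV hW i) y).symm

theorem IsAffineOpen.coheight_fromSpec {X : Scheme.{u}} {V : X.Opens} (hV : IsAffineOpen V)
    (y : PrimeSpectrum Γ(X, V)) : Order.coheight (hV.fromSpec y) = y.asIdeal.height := by
  have := idealHeight_eq_coheight Γ(X, V) y
  rw [this]; exact coheight_eq_of_isOpenImmersion hV.fromSpec

theorem Scheme.Hom.appLE_injective {X Y : Scheme.{u}} [IsIntegral X] [IsIntegral Y] (f : X ⟶ Y)
    [IsDominant f] {V : Y.Opens} {W : X.Opens} (hW : (W : Set X).Nonempty) (i : W ≤ f ⁻¹ᵁ V) :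
    Function.Injective (f.appLE V W i).hom := by
  rw [injective_iff_map_eq_zero]
  intro a ha
  by_contra h0
  have hbot : Y.basicOpen a ≠ ⊥ := fun h ↦ h0 ((basicOpen_eq_bot_iff a).mp h)
  obtain ⟨x, hx⟩ := f.denseRange.exists_mem_open (Y.basicOpen a).isOpen
    (Set.nonempty_iff_ne_empty.mpr fun h ↦ hbot (Opens.ext h))
  have hmeet := nonempty_preirreducible_inter W.isOpen (f ⁻¹ᵁ Y.basicOpen a).isOpen hW ⟨x, hx⟩
  have := Scheme.basicOpen_appLE f W V i a
  rw [show f.appLE V W i a = 0 from ha, Scheme.basicOpen_zero] at this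
  obtain ⟨z, hz⟩ := hmeet
  exact (this.symm.le hz : z ∈ (⊥ : X.Opens))

/-- Generic going down and generic surjectivity for a dominant morphism on an affine chart. -/
theorem exists_section_forall_specializes {k : Type u} [Field k] [PerfectField k]
    {X Y : Scheme.{u}} [IsIntegral X] [IsIntegral Y] (s : Y ⟶ Spec (.of k)) [LocallyOfFiniteType s]
    (f : X ⟶ Y) [IsDominant f] [LocallyOfFiniteType f] {V : Y.Opens} {W : X.Opens}
    (hV : IsAffineOpen V) (hW : IsAffineOpen W) (hne : (W : Set X).Nonempty) (i : W ≤ f ⁻¹ᵁ V) :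
    ∃ a : Γ(Y, V), a ≠ 0 ∧ (Y.basicOpen a : Set Y) ⊆ Set.range f ∧
      ∀ x ∈ W, f x ∈ Y.basicOpen a →
        (∀ y, y ⤳ f x → ∃ z, z ⤳ x ∧ f z = y) ∧
        ((∀ z, z ⤳ x → f z = f x → z = x) → Order.coheight x = Order.coheight (f x)) := by
  let := (s.fieldToSections V).toAlgebra
  have : Algebra.FiniteType k Γ(Y, V) := s.finiteType_fieldToSections hV
  let := (f.appLE V W i).hom.toAlgebra
  have : Algebra.FiniteType Γ(Y, V) Γ(X, W) := f.finiteType_appLE hV hW i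
  have : Nonempty W := hne.to_subtype
  have : Nonempty V := ⟨⟨f hne.some, i hne.some_mem⟩⟩
  have : IsNoetherianRing Γ(Y, V) := Algebra.FiniteType.isNoetherianRing k _
  have : IsNoetherianRing Γ(X, W) := Algebra.FiniteType.isNoetherianRing Γ(Y, V) _
  obtain ⟨a, ha, hgd, hsurj⟩ :=
    exists_forall_exists_le_under_eq k Γ(Y, V) Γ(X, W) (f.appLE_injective hne i)
  have happly (y : PrimeSpectrum Γ(X, W)) : f (hW.fromSpec y) =
      hV.fromSpec ⟨y.asIdeal.under Γ(Y, V), inferInstance⟩ := hV.apply_fromSpec f hW i y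
  have hinj {p q : PrimeSpectrum Γ(X, W)} (h : hW.fromSpec p = hW.fromSpec q) : p = q :=
    hW.fromSpec.isOpenEmbedding.injective h
  refine ⟨a, ha, fun y hy ↦ ?_, fun x hx hfx ↦ ?_⟩
  · obtain ⟨p, rfl⟩ := hV.exists_fromSpec_eq (Y.basicOpen_le a hy)
    obtain ⟨Q, hQ, hQp⟩ := hsurj p.asIdeal p.2 (hV.fromSpec_mem_basicOpen.mp hy)
    refine ⟨hW.fromSpec ⟨Q, hQ⟩, ?_⟩
    rw [happly]
    congr 1
    exact PrimeSpectrum.ext hQp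
  · obtain ⟨P, rfl⟩ := hW.exists_fromSpec_eq hx
    rw [happly, hV.fromSpec_mem_basicOpen] at hfx
    refine ⟨fun y hy ↦ ?_, fun hmin ↦ ?_⟩
    · have hyV : y ∈ V := hy.mem_open V.isOpen (i hx)
      obtain ⟨p, rfl⟩ := hV.exists_fromSpec_eq hyV
      rw [happly, hV.fromSpec_specializes_iff] at hy
      obtain ⟨Q, hQP, hQ, hQp⟩ := hgd P.asIdeal P.2 hfx p.asIdeal p.2 hy
      refine ⟨hW.fromSpec ⟨Q, hQ⟩, hW.fromSpec_specializes_iff.mpr hQP, ?_⟩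
      rw [happly]
      congr 1
      exact PrimeSpectrum.ext hQp
    · rw [happly, hW.coheight_fromSpec, hV.coheight_fromSpec]
      refine Ideal.height_eq_height_under_of_forall_exists_le P.asIdeal
        (fun Q hQP hQ p hp hpQ ↦ hgd Q hQ (fun h ↦ hfx (hQP h)) p hp hpQ) ?_
      refine ⟨⟨P.2, Ideal.map_le_iff_le_comap.mpr le_rfl⟩, fun Q hQ hQP ↦ ?_⟩
      have h := hmin (hW.fromSpec ⟨Q, hQ.1⟩) (hW.fromSpec_specializes_iff.mpr hQP) (by
        rw [happly, happly]
        congr 1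
        exact PrimeSpectrum.ext (le_antisymm (Ideal.comap_mono hQP)
          (Ideal.map_le_iff_le_comap.mp hQ.2)))
      exact (congrArg PrimeSpectrum.asIdeal (hinj h)).ge

/-- Generic going down and generic surjectivity for a dominant morphism of finite type. -/
theorem exists_opens_forall_specializes {k : Type u} [Field k] [PerfectField k]
    {X Y : Scheme.{u}} [IsIntegral X] [IsIntegral Y] (s : Y ⟶ Spec (.of k)) [LocallyOfFiniteType s]
    (f : X ⟶ Y) [IsDominant f] [LocallyOfFiniteType f] [QuasiCompact f] :
    ∃ U : Y.Opens, (U : Set Y).Nonempty ∧ (U : Set Y) ⊆ Set.range f ∧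
      ∀ x, f x ∈ U → (∀ y, y ⤳ f x → ∃ z, z ⤳ x ∧ f z = y) ∧
        ((∀ z, z ⤳ x → f z = f x → z = x) → Order.coheight x = Order.coheight (f x)) := by
  obtain ⟨V, hV, hη, -⟩ := exists_isAffineOpen_mem_and_subset (U := ⊤) (x := genericPoint Y) trivial
  have : Nonempty V := ⟨⟨_, hη⟩⟩
  have hc : IsCompact (f ⁻¹ᵁ V : Set X) := QuasiCompact.isCompact_preimage _ V.isOpen hV.isCompact
  obtain ⟨S, hS, hSV⟩ := (isCompact_and_isOpen_iff_finite_and_eq_biUnion_affineOpens (X := X)).mp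
    ⟨hc, (f ⁻¹ᵁ V).isOpen⟩
  have hle (W) (hW : W ∈ S) : W.1 ≤ f ⁻¹ᵁ V := fun x hx ↦ by
    have : x ∈ (f ⁻¹ᵁ V : Set X) := hSV ▸ Set.mem_biUnion hW hx
    exact this
  have key (W : X.affineOpens) : ∃ a : Γ(Y, V), a ≠ 0 ∧ ((W.1 : Set X).Nonempty → W ∈ S →
      (Y.basicOpen a : Set Y) ⊆ Set.range f ∧ ∀ x ∈ W.1, f x ∈ Y.basicOpen a →
        (∀ y, y ⤳ f x → ∃ z, z ⤳ x ∧ f z = y) ∧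
        ((∀ z, z ⤳ x → f z = f x → z = x) → Order.coheight x = Order.coheight (f x))) := by
    by_cases h : (W.1 : Set X).Nonempty ∧ W ∈ S
    · obtain ⟨a, ha, h⟩ := exists_section_forall_specializes s f hV W.2 h.1 (hle W h.2)
      exact ⟨a, ha, fun _ _ ↦ h⟩
    · exact ⟨1, one_ne_zero, fun h1 h2 ↦ (h ⟨h1, h2⟩).elim⟩
  choose a ha h using key
  have hcover (x) (hx : f x ∈ V) : ∃ W ∈ S, x ∈ W.1 := by
    have : x ∈ (f ⁻¹ᵁ V : Set X) := hx
    rw [hSV] at this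
    simpa using this
  have hbas (W) (hW : W ∈ S) : Y.basicOpen (∏ W ∈ hS.toFinset, a W) ≤ Y.basicOpen (a W) := by
    obtain ⟨b, hb⟩ := Finset.dvd_prod_of_mem a (hS.mem_toFinset.mpr hW)
    rw [hb, Scheme.basicOpen_mul]
    exact inf_le_left
  refine ⟨Y.basicOpen (∏ W ∈ hS.toFinset, a W), ?_, ?_, fun x hx ↦ ?_⟩
  · rw [Set.nonempty_iff_ne_empty]
    intro h0
    exact Finset.prod_ne_zero_iff.mpr (fun W _ ↦ ha W) ((basicOpen_eq_bot_iff _).mp (Opens.ext h0))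
  · obtain ⟨x, hx⟩ := f.denseRange.exists_mem_open V.isOpen ⟨_, hη⟩
    obtain ⟨W, hW, hxW⟩ := hcover x hx
    exact fun y hy ↦ (h W ⟨x, hxW⟩ hW).1 (hbas W hW hy)
  · obtain ⟨W, hW, hxW⟩ := hcover x (Y.basicOpen_le _ hx)
    exact (h W ⟨x, hxW⟩ hW).2 x hxW (hbas W hW hx)

theorem ringKrullDim_le_of_injective_algebraMap (k : Type u) {A B : Type u} [Field k] [CommRing A]
    [IsDomain A] [CommRing B] [IsDomain B] [Algebra k A] [Algebra.FiniteType k A] [Algebra k B]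
    [Algebra.FiniteType k B] (φ : A →ₐ[k] B) (hφ : Function.Injective φ) :
    ringKrullDim A ≤ ringKrullDim B := by
  obtain ⟨m, hm, hA, -⟩ := exists_ringKrullDim_eq_trdeg k A
  obtain ⟨n, hn, hB, -⟩ := exists_ringKrullDim_eq_trdeg k B
  have := trdeg_le_of_injective φ hφ
  rw [hm, hn] at this
  rw [hA, hB]
  exact_mod_cast this

theorem topologicalKrullDim_le_of_isDominant {k : Type u} [Field k] {X Y : Scheme.{u}}
    [IsIntegral X] [IsIntegral Y] (s : Y ⟶ Spec (.of k)) [LocallyOfFiniteType s] (f : X ⟶ Y)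
    [IsDominant f] [LocallyOfFiniteType f] : topologicalKrullDim Y ≤ topologicalKrullDim X := by
  obtain ⟨dX, hX, hX', -⟩ := exists_height_add_coheight_eq (f ≫ s)
  obtain ⟨dY, hY, hY', -⟩ := exists_height_add_coheight_eq s
  obtain ⟨V, hV, hη, -⟩ := exists_isAffineOpen_mem_and_subset (U := ⊤) (x := f (genericPoint X))
    trivial
  obtain ⟨W, hW, hηW, i⟩ := exists_isAffineOpen_mem_and_subset (U := f ⁻¹ᵁ V)
    (x := genericPoint X) hη
  have : Nonempty V := ⟨⟨_, hη⟩⟩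
  have : Nonempty W := ⟨⟨_, hηW⟩⟩
  let := (s.fieldToSections V).toAlgebra
  have : Algebra.FiniteType k Γ(Y, V) := s.finiteType_fieldToSections hV
  let := ((f ≫ s).fieldToSections W).toAlgebra
  have : Algebra.FiniteType k Γ(X, W) := (f ≫ s).finiteType_fieldToSections hW
  let φ : Γ(Y, V) →ₐ[k] Γ(X, W) :=
    { (f.appLE V W i).hom with
      commutes' := fun c ↦ congr($(Scheme.Hom.appLE_comp_fieldToSections s f i) c) }
  rw [hX, hY, ← hX' W hW ⟨_, hηW⟩, ← hY' V hV ⟨_, hη⟩]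
  exact ringKrullDim_le_of_injective_algebraMap k φ (f.appLE_injective ⟨_, hηW⟩ i)

end AlgebraicGeometry

theorem maximal_of_mem_irreducibleComponentsOf {T : Type*} [TopologicalSpace T] {S Z : Set T}
    (hZ : Z ∈ irreducibleComponentsOf S) : Maximal (fun C ↦ IsIrreducible C ∧ C ⊆ S) Z := by
  obtain ⟨C, hC, rfl⟩ := hZ
  refine ⟨⟨hC.1.image _ continuous_subtype_val.continuousOn, by simp⟩, fun D hD hCD ↦ ?_⟩
  have hD' : Subtype.val '' (Subtype.val ⁻¹' D : Set S) = D := by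
    rw [Subtype.image_preimage_coe]
    exact Set.inter_eq_right.mpr hD.2
  have hirr : IsIrreducible (Subtype.val ⁻¹' D : Set S) := by
    refine ⟨Set.image_nonempty.mp (hD' ▸ hD.1.1), ?_⟩
    rintro _ _ ⟨u, hu, rfl⟩ ⟨v, hv, rfl⟩ ⟨x, hx, hxu⟩ ⟨y, hy, hyv⟩
    obtain ⟨t, ht, htu, htv⟩ := hD.1.2 u v hu hv ⟨x, hx, hxu⟩ ⟨y, hy, hyv⟩
    exact ⟨⟨t, hD.2 ht⟩, ht, htu, htv⟩
  rw [← hD']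
  exact Set.image_mono (hC.2 hirr (Set.image_subset_iff.mp hCD))

theorem theorem3p2 {k : Type u} [Field k] [IsAlgClosed k]
    {X Y : Over (Spec (CommRingCat.of k))} [IsVariety X] [IsVariety Y]
    (f : X ⟶ Y) [IsDominant f.left] :
    ∃ d r : ℕ,
      topologicalKrullDim Y.left = (d : WithBot ℕ∞) ∧
      topologicalKrullDim X.left = ((d + r : ℕ) : WithBot ℕ∞) ∧
      ∃ U : Y.left.Opens,
        (U : Set Y.left).Nonempty ∧
        (U : Set Y.left) ⊆ Set.range f.left ∧
        ∀ W : IrreducibleCloseds Y.left, ((W : Set Y.left) ∩ U).Nonempty →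
          ∀ Z : IrreducibleCloseds X.left,
            (Z : Set X.left) ∈ irreducibleComponentsOf (f.left ⁻¹' (W : Set Y.left)) →
            ((Z : Set X.left) ∩ f.left ⁻¹' (U : Set Y.left)).Nonempty →
            topologicalKrullDim (Z : Set X.left) =
                topologicalKrullDim (W : Set Y.left) + (r : WithBot ℕ∞) ∧
              codimension Z = codimension W := by
  have := IsVariety.isIntegral (X := X)
  have := IsVariety.isIntegral (X := Y)
  have := IsVariety.locallyOfFiniteType (X := X)
  have := IsVariety.locallyOfFiniteType (X := Y)
  have := IsVariety.quasiCompact (X := X)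
  have := IsVariety.isSeparated (X := Y)
  have hlft : LocallyOfFiniteType (f.left ≫ Y.hom) := by rw [Over.w f]; assumption
  have hqc : QuasiCompact (f.left ≫ Y.hom) := by rw [Over.w f]; assumption
  have : LocallyOfFiniteType f.left := locallyOfFiniteType_of_comp f.left Y.hom
  have : QuasiCompact f.left :=
    MorphismProperty.of_postcomp (W := @QuasiCompact) (W' := @QuasiSeparated) f.left Y.hom
      inferInstance hqc
  obtain ⟨dX, hdX, -, hX⟩ := exists_height_add_coheight_eq X.hom
  obtain ⟨dY, hdY, -, hY'⟩ := exists_height_add_coheight_eq Y.hom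
  obtain ⟨U, hU, hUf, H⟩ := exists_opens_forall_specializes Y.hom f.left
  have hle := topologicalKrullDim_le_of_isDominant Y.hom f.left
  rw [hdX, hdY] at hle
  obtain ⟨r, rfl⟩ := Nat.exists_eq_add_of_le (show dY ≤ dX by exact_mod_cast hle)
  refine ⟨dY, r, hdY, hdX, U, hU, hUf, fun W hW Z hZ hZU ↦ ?_⟩
  obtain ⟨w, hw⟩ := QuasiSober.sober W.isIrreducible W.isClosed
  obtain ⟨z, hz⟩ := QuasiSober.sober Z.isIrreducible Z.isClosed
  have hwU : w ∈ U := by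
    obtain ⟨y, hy, hyU⟩ := hW
    exact (hw.specializes hy).mem_open U.isOpen hyU
  have hzU : f.left z ∈ U := by
    obtain ⟨x, hx, hxU⟩ := hZU
    exact (hz.specializes hx).mem_open (f.left ⁻¹ᵁ U).isOpen hxU
  obtain ⟨⟨-, hZW⟩, hmax⟩ := maximal_of_mem_irreducibleComponentsOf hZ
  have hfz : f.left z ∈ (W : Set Y.left) := hZW hz.mem
  have hZmax (z') (hzz' : z' ⤳ z) (hz' : f.left z' ∈ (W : Set Y.left)) : z' = z := by
    have hS : IsClosed (f.left ⁻¹' (W : Set Y.left)) := W.isClosed.preimage f.left.continuous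
    have hz'Z : z' ∈ (Z : Set X.left) := hmax
      ⟨isIrreducible_singleton.closure, hS.closure_subset_iff.mpr (Set.singleton_subset_iff.mpr hz')⟩
      (hz.def.ge.trans (hzz'.closure_subset)) (subset_closure rfl)
    exact (hzz'.antisymm (hz.specializes hz'Z)).eq
  obtain ⟨hgd, hco⟩ := H z hzU
  obtain ⟨z', hz', rfl⟩ := hgd w (hw.specializes hfz)
  obtain rfl := hZmax z' hz' hw.mem
  have hco := hco fun z hz hfz' ↦ hZmax z hz (by rwa [hfz'])
  refine ⟨?_, by rw [codimension_eq_coheight hz.symm, codimension_eq_coheight hw.symm, hco]⟩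
  rw [topologicalKrullDim_eq_height hz.symm, topologicalKrullDim_eq_height hw.symm]
  have hx := hX z'
  have hy := hY' (f.left z')
  rw [hco] at hx
  have hne : Order.coheight (f.left z') ≠ ⊤ := fun h ↦ by simp [h] at hy
  have : Order.height z' = Order.height (f.left z') + r := by
    apply ENat.add_left_injective_of_ne_top hne
    change _ + _ = _ + _
    rw [hx, add_right_comm, hy, Nat.cast_add]
  rw [this]
  rfl
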